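/- Let $\Omega$ be a finite alphabet with $A$ letters, let $k\ge 0$, and let $M:\Omega\times\Omega^k\to(0,1)$, $(a,w)\mapsto M(a\mid w)$, be a $k$th-order Markov kernel, i.e. $\sum_{a\in\Omega}M(a\mid w)=1$ for all $w\in\Omega^k$. Let $\pi$ be its stationary distribution, i.e. the probability distribution on $\Omega^k$ with $\pi(a_2^{k+1})=\sum_{a_1\in\Omega}M(a_{k+1}\mid a_1^k)\,\pi(a_1^k)$, and let $$H(M):=-\sum_{a_1^k\in\Omega^k}\pi(a_1^k)\sum_{b\in\Omega}M(b\mid a_1^k)\log M(b\mid a_1^k)$$ be the entropy rate. *The game.* In the time-homogeneous $k$th-order Markovian predictive game, Skeptic's capital starts at $K_0=1$. In each round $n=1,2,\dots$, Forecaster announces $p_n:\Omega\to(0,1)$ with $\sum_a p_n(a)=1$, where $p_n(a)=M(a\mid\omega_{n-k}^{n-1})$ if $n>k$ (and $p_n$ is arbitrary if $n\le k$); Skeptic announces $\alpha_n\in\mathbb R^\Omega$; Reality announces $\omega_n\in\Omega$; and $$K_n:=K_{n-1}\Big\{1+\sum_{a\in\Omega}\alpha_n(a)\big(\delta_{\omega_n}(a)-p_n(a)\big)\Big\}.$$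 A strategy of Skeptic is a map $\alpha:\Omega^*\to\mathbb R^\Omega$, played as $\alpha_n=\alpha(\omega_1^{n-1})$; it is prudent if $K_n>0$ for all $n$, whatever the moves of Forecaster and Reality. *The Lempel–Ziv probability.* Incremental parsing cuts a word, from left to right, into phrases, each being the shortest word that is not among the previous phrases; thus $\omega_1^{n-1}$ is cut into distinct phrases $x_1,\dots,x_T$ followed by a (possibly empty) remainder $r$. Let $V$ be the set of words $\xi\notin\{\lambda,x_1,\dots,x_T\}$ of the form $\xi=xb$ with $x\in\{\lambda,x_1,\dots,x_T\}$ and $b\in\Omega$, where $\lambda$ is the empty word. Put $$Q_{LZ}(a\mid\omega_1^{n-1}):=\frac{|\{\xi\in V: ra \text{ is a prefix of }\xi\}|}{|\{\xi\in V: r\text{ is a prefix of }\xi\}|},\qquad Q_{LZ}(\omega_1^n):=\prod_{i=1}^n Q_{LZ}(\omega_i\mid\omega_1^{i-1})$$ (so $Q_{LZ}(a\mid\lambda)=1/A$). **Proposition.** In the time-homogeneous $k$th-order Markovian predictive game, Skeptic has a prudent strategy $\alpha:\Omega^*\to\mathbb R^\Omega$ that ensures $\lim_{n\to\infty}K_n=\infty$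 unless $$\lim_{n\to\infty}\frac{-\log Q_{LZ}(\omega_1^n)}{n}=H(M).$$ -/

import Mathlib

/-!
Words are lists over a finite alphabet `Ω`.  An infinite sequence `ω₁ω₂ω₃⋯` is a function
`ω : ℕ → Ω`, with `ω i` the letter in position `i + 1`; likewise `p n` is Forecaster's
announcement in round `n + 1`.
-/

namespace LZGame

/-- The word `ω₁ ⋯ ωₙ`. -/
def pre {Ω : Type*} (ω : ℕ → Ω) (n : ℕ) : List Ω :=
  (List.range n).map ω

section LempelZiv

variable {Ω : Type*} [DecidableEq Ω]

/-- One letter of incremental parsing.  The state consists of the phrases marked off so far and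
the current incomplete phrase; a slash is set as soon as the latter is a new phrase. -/
def parseStep (s : List (List Ω) × List Ω) (a : Ω) : List (List Ω) × List Ω :=
  if s.2 ++ [a] ∈ s.1 then (s.1, s.2 ++ [a]) else (s.1 ++ [s.2 ++ [a]], [])

/-- Incremental parsing of a word: the list of its parsed phrases, in order, and the (possibly
empty) remaining word behind the last slash. -/
def parse (w : List Ω) : List (List Ω) × List Ω :=
  w.foldl parseStep ([], [])

variable [Fintype Ω]

/-- The set of candidates for the next phrase: the words that extend a parsed phrase or the empty
word by one letter and are neither a parsed phrase nor the empty word. -/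
def candidates (phrases : List (List Ω)) : Finset (List Ω) :=
  ((([] :: phrases).toFinset ×ˢ (Finset.univ : Finset Ω)).image
    fun x => x.1 ++ [x.2]).filter fun ξ => ξ ∉ [] :: phrases

/-- The number of candidates for the next phrase after the word `w` has been parsed which have
the word `x` as a prefix. -/
def numCandidates (w x : List Ω) : ℕ :=
  ((candidates (parse w).1).filter fun ξ => x <+: ξ).card

/-- The Lempel–Ziv conditional probability of the letter `a` after the word `w`.
For the empty word it is `1 / |Ω|`. -/
noncomputable def condLZ (a : Ω) (w : List Ω) : ℝ :=
  (numCandidates w ((parse w).2 ++ [a]) : ℝ) / (numCandidates w (parse w).2 : ℝ)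

/-- The Lempel–Ziv probability of the word `ω₁ ⋯ ωₙ`. -/
noncomputable def probLZ (ω : ℕ → Ω) (n : ℕ) : ℝ :=
  ∏ i ∈ Finset.range n, condLZ (ω i) (pre ω i)

end LempelZiv

section Game

variable {Ω : Type*} [Fintype Ω]

/-- Strictly positive probability functions with values in the open unit interval. -/
structure IsForecast (p : Ω → ℝ) : Prop where
  mem_Ioo : ∀ a, p a ∈ Set.Ioo (0 : ℝ) 1
  sum_eq_one : ∑ a, p a = 1

/-- `M a w` stands for `M(a ∣ w)`. -/
def IsMarkovKernel {k : ℕ} (M : Ω → (Fin k → Ω) → ℝ) : Prop :=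
  ∀ w, IsForecast fun a => M a w

/-- Stationary distributions of a `k`-th order Markov kernel: probability distributions `π` on
words of length `k` such that `π(a₂ ⋯ aₖ₊₁) = ∑ M(aₖ₊₁ ∣ a₁ ⋯ aₖ) π(a₁ ⋯ aₖ)`, where the sum
is over the letter `a₁`. -/
structure IsStationary {k : ℕ} (M : Ω → (Fin k → Ω) → ℝ) (π : (Fin k → Ω) → ℝ) : Prop where
  nonneg : ∀ w, 0 ≤ π w
  sum_eq_one : ∑ w, π w = 1
  invariant : ∀ c : Fin k → Ω, π c = ∑ d : Ω,
    M ((Fin.cons d c : Fin (k + 1) → Ω) (Fin.last k)) (Fin.init (Fin.cons d c : Fin (k + 1) → Ω)) *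
      π (Fin.init (Fin.cons d c : Fin (k + 1) → Ω))

/-- The entropy rate of `M`, where `π` is the stationary distribution of `M`. -/
noncomputable def entropyRate {k : ℕ} (M : Ω → (Fin k → Ω) → ℝ) (π : (Fin k → Ω) → ℝ) : ℝ :=
  -∑ w, π w * ∑ b, M b w * Real.log (M b w)

/-- The moves `p` of Forecaster and `ω` of Reality obey the protocol of the time-homogeneous
`k`-th order Markovian predictive game: in every round Forecaster announces a strictly positive
probability function, which from round `k + 1` on is given by `M` and the last `k` moves of
Reality.  The first `k` announcements are free. -/
structure IsPlay {k : ℕ} (M : Ω → (Fin k → Ω) → ℝ) (p : ℕ → Ω → ℝ) (ω : ℕ → Ω) : Prop where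
  forecast : ∀ n, IsForecast (p n)
  markov : ∀ n, k ≤ n → ∀ a, p n a = M a fun i : Fin k => ω (n - k + i)

/-- Skeptic's capital after `n` rounds, starting from `1`, with the strategy `α`, which assigns
to Reality's past moves the bets per unit of the present capital. -/
noncomputable def capital [DecidableEq Ω] (α : List Ω → Ω → ℝ) (p : ℕ → Ω → ℝ) (ω : ℕ → Ω) :
    ℕ → ℝ
  | 0 => 1
  | n + 1 => capital α p ω n *
      (1 + ∑ a, α (pre ω n) a * ((if ω n = a then 1 else 0) - p n a))

/-- A strategy is prudent if the capital stays positive, whatever the other players do. -/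
def IsPrudent [DecidableEq Ω] {k : ℕ} (M : Ω → (Fin k → Ω) → ℝ) (α : List Ω → Ω → ℝ) : Prop :=
  ∀ p ω, IsPlay M p ω → ∀ n, 0 < capital α p ω n

end Game

end LZGame

/-!
Let `P` be the probability of words under `M`. By mixing positive supermartingales with respect
to `M`, Skeptic can force countably many events at once.

The likelihood ratio `Q_LZ / P` is such a supermartingale, hence can be forced to be eventually at
most `(n + 1)²`, so `-log Q_LZ ≥ -log P - O(log n)`. The converse `-log Q_LZ ≤ -log P + o(n)` holds
along every sequence: if the word has `T` phrases, then `-log Q_LZ ≤ T log T + O(T)` by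
telescoping, whereas distinct phrases cannot all be likely, which is Ziv's inequality
`-log P ≥ T log T - O(T) - o(n)`; and `T = o(n)`.

By the Poisson equation `-log P - n H(M)` is, up to a bounded term, a martingale with bounded
increments, and exponential supermartingales force such a martingale to be `o(n)`.
-/

open Filter Topology Asymptotics

namespace LZGame

/-! ## Predictors -/

section Predictor

variable {Ω : Type*}

@[simp] theorem pre_zero (ω : ℕ → Ω) : pre ω 0 = [] := rfl

theorem pre_succ (ω : ℕ → Ω) (n : ℕ) : pre ω (n + 1) = pre ω n ++ [ω n] := by
  simp [pre, List.range_succ]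

@[simp] theorem length_pre (ω : ℕ → Ω) (n : ℕ) : (pre ω n).length = n := by
  simp [pre]

theorem take_pre (ω : ℕ → Ω) {m n : ℕ} (h : m ≤ n) : (pre ω n).take m = pre ω m := by
  simp [pre, ← List.map_take, List.take_range, h]

/-- The probability that the conditional probabilities `q w a` of the letter `a` after the word
`w` assign to a whole word. -/
def wordProb : (List Ω → Ω → ℝ) → List Ω → ℝ
  | _, [] => 1
  | q, a :: w => q [] a * wordProb (fun u => q (a :: u)) w

@[simp] theorem wordProb_nil (q : List Ω → Ω → ℝ) : wordProb q [] = 1 := rfl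

theorem wordProb_append (q : List Ω → Ω → ℝ) (u v : List Ω) :
    wordProb q (u ++ v) = wordProb q u * wordProb (fun w => q (u ++ w)) v := by
  induction u generalizing q with
  | nil => simp
  | cons a u ih => simp [wordProb, ih, mul_assoc]

theorem wordProb_append_singleton (q : List Ω → Ω → ℝ) (w : List Ω) (a : Ω) :
    wordProb q (w ++ [a]) = wordProb q w * q w a := by
  simp [wordProb_append, wordProb]

theorem wordProb_pre (q : List Ω → Ω → ℝ) (ω : ℕ → Ω) (n : ℕ) :
    wordProb q (pre ω n) = ∏ i ∈ Finset.range n, q (pre ω i) (ω i) := by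
  induction n with
  | zero => simp
  | succ n ih => rw [pre_succ, wordProb_append_singleton, ih, Finset.prod_range_succ]

variable [Fintype Ω]

/-- A predictor: `q w a` is the conditional probability, required to be positive, of the letter
`a` after the word `w`. -/
structure IsPredictor (q : List Ω → Ω → ℝ) : Prop where
  pos : ∀ w a, 0 < q w a
  sum_eq_one : ∀ w, ∑ a, q w a = 1

namespace IsPredictor

variable {q : List Ω → Ω → ℝ}

theorem comp_append (hq : IsPredictor q) (u : List Ω) : IsPredictor fun w => q (u ++ w) where
  pos _ := hq.pos _
  sum_eq_one _ := hq.sum_eq_one _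

theorem wordProb_pos (hq : IsPredictor q) (w : List Ω) : 0 < wordProb q w := by
  induction w generalizing q with
  | nil => exact one_pos
  | cons a w ih => exact mul_pos (hq.pos _ _) (ih (hq.comp_append [a]))

theorem sum_wordProb_ofFn (hq : IsPredictor q) (l : ℕ) :
    ∑ x : Fin l → Ω, wordProb q (List.ofFn x) = 1 := by
  induction l generalizing q with
  | zero => simp
  | succ l ih =>
    have htail (a : Ω) : ∑ x : Fin l → Ω, wordProb (fun u => q (a :: u)) (List.ofFn x) = 1 :=
      ih (hq.comp_append [a])
    rw [← (Fin.consEquiv fun _ : Fin (l + 1) => Ω).sum_comp, Fintype.sum_prod_type]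
    simp only [Fin.consEquiv, Equiv.coe_fn_mk, List.ofFn_succ, Fin.cons_zero, Fin.cons_succ,
      wordProb, ← Finset.mul_sum, htail, mul_one, hq.sum_eq_one]

theorem sum_wordProb_le_one (hq : IsPredictor q) {l : ℕ} {X : Finset (List Ω)}
    (hX : ∀ x ∈ X, x.length = l) : ∑ x ∈ X, wordProb q x ≤ 1 := by
  classical
  rw [← hq.sum_wordProb_ofFn l, ← Finset.sum_image (g := List.ofFn) List.ofFn_injective.injOn]
  refine Finset.sum_le_sum_of_subset_of_nonneg (fun x hx => ?_) fun x _ _ =>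
    (hq.wordProb_pos x).le
  obtain rfl := hX x hx
  exact Finset.mem_image.2 ⟨x.get, Finset.mem_univ _, List.ofFn_get x⟩

theorem wordProb_le_one (hq : IsPredictor q) (w : List Ω) : wordProb q w ≤ 1 := by
  simpa using hq.sum_wordProb_le_one (l := w.length) (X := {w}) (by simp)

theorem wordProb_append_le (hq : IsPredictor q) (u v : List Ω) :
    wordProb q (u ++ v) ≤ wordProb q u := by
  rw [wordProb_append]
  exact mul_le_of_le_one_right (hq.wordProb_pos u).le ((hq.comp_append u).wordProb_le_one v)

/-- The factor `θ ^ l` pays for taking words of all lengths `l`. -/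
theorem sum_pow_length_mul_wordProb_le (hq : IsPredictor q) {θ : ℝ} (hθ : 0 ≤ θ) (hθ' : θ < 1)
    (X : Finset (List Ω)) : ∑ x ∈ X, θ ^ x.length * wordProb q x ≤ (1 - θ)⁻¹ := by
  have hfiber (l : ℕ) : ∑ x ∈ X with x.length = l, θ ^ x.length * wordProb q x ≤ θ ^ l :=
    calc ∑ x ∈ X with x.length = l, θ ^ x.length * wordProb q x
        = θ ^ l * ∑ x ∈ X with x.length = l, wordProb q x := by
          rw [Finset.mul_sum]
          refine Finset.sum_congr rfl fun x hx => ?_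
          rw [(Finset.mem_filter.1 hx).2]
      _ ≤ θ ^ l := mul_le_of_le_one_right (pow_nonneg hθ l)
          (hq.sum_wordProb_le_one fun x hx => (Finset.mem_filter.1 hx).2)
  calc ∑ x ∈ X, θ ^ x.length * wordProb q x
      = ∑ l ∈ X.image List.length, ∑ x ∈ X with x.length = l, θ ^ x.length * wordProb q x :=
        (Finset.sum_fiberwise_of_maps_to (fun x hx => Finset.mem_image_of_mem _ hx) _).symm
    _ ≤ ∑ l ∈ X.image List.length, θ ^ l := Finset.sum_le_sum fun l _ => hfiber l
    _ ≤ ∑' l, θ ^ l := (summable_geometric_of_lt_one hθ hθ').sum_le_tsum _ fun l _ =>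
        pow_nonneg hθ l
    _ = (1 - θ)⁻¹ := tsum_geometric_of_lt_one hθ hθ'

end IsPredictor

end Predictor

/-! ## Supermartingales and forcing -/

section Supermartingale

variable {Ω : Type*} [Fintype Ω] {q : List Ω → Ω → ℝ}

/-- Positive supermartingales with respect to the predictor `q`: the capital processes that
Skeptic can achieve, possibly throwing away money, when Forecaster announces `q`. -/
structure IsSupermartingale (q : List Ω → Ω → ℝ) (W : List Ω → ℝ) : Prop where
  pos : ∀ w, 0 < W w
  sum_le : ∀ w, ∑ a, q w a * W (w ++ [a]) ≤ W w

namespace IsSupermartingale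

variable {V W : List Ω → ℝ}

theorem add (hV : IsSupermartingale q V) (hW : IsSupermartingale q W) :
    IsSupermartingale q fun w => V w + W w where
  pos w := add_pos (hV.pos w) (hW.pos w)
  sum_le w := by
    simp only [mul_add, Finset.sum_add_distrib]
    exact add_le_add (hV.sum_le w) (hW.sum_le w)

theorem const_mul (hW : IsSupermartingale q W) {c : ℝ} (hc : 0 < c) :
    IsSupermartingale q fun w => c * W w where
  pos w := mul_pos hc (hW.pos w)
  sum_le w := by
    simp only [mul_left_comm _ c, ← Finset.mul_sum]
    exact mul_le_mul_of_nonneg_left (hW.sum_le w) hc.le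

theorem comp_take (hW : IsSupermartingale q W) (hq : IsPredictor q) (n : ℕ) :
    IsSupermartingale q fun w => W (w.take n) where
  pos w := hW.pos _
  sum_le w := by
    rcases le_or_gt n w.length with h | h
    · simp only [List.take_append_of_le_length h, ← Finset.sum_mul, hq.sum_eq_one, one_mul, le_refl]
    · have htake (a : Ω) : (w ++ [a]).take n = w ++ [a] :=
        List.take_of_length_le (by rwa [List.length_append, List.length_singleton])
      simp only [htake, List.take_of_length_le h.le]
      exact hW.sum_le w

theorem wordProb_mul_le (hW : IsSupermartingale q W) (hq : IsPredictor q) (w : List Ω) :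
    wordProb q w * W w ≤ W [] := by
  induction w using List.reverseRecOn with
  | nil => simp
  | append_singleton w a ih =>
    have hstep : q w a * W (w ++ [a]) ≤ W w :=
      (Finset.single_le_sum (f := fun b => q w b * W (w ++ [b]))
        (fun b _ => (mul_pos (hq.pos _ _) (hW.pos _)).le) (Finset.mem_univ a)).trans (hW.sum_le w)
    rw [wordProb_append_singleton, mul_assoc]
    exact (mul_le_mul_of_nonneg_left hstep (hq.wordProb_pos w).le).trans ih

theorem wordProb_div {r : List Ω → Ω → ℝ} (hr : IsPredictor r) (hq : IsPredictor q) :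
    IsSupermartingale q fun w => wordProb r w / wordProb q w where
  pos w := div_pos (hr.wordProb_pos w) (hq.wordProb_pos w)
  sum_le w := by
    have hterm (a : Ω) : q w a * (wordProb r (w ++ [a]) / wordProb q (w ++ [a])) =
        wordProb r w / wordProb q w * r w a := by
      have := (hq.pos w a).ne'
      have := (hq.wordProb_pos w).ne'
      rw [wordProb_append_singleton, wordProb_append_singleton]
      field_simp
    simp only [hterm, ← Finset.mul_sum, hr.sum_eq_one, mul_one, le_refl]

theorem exp (hq : IsPredictor q) {X : List Ω → ℝ} (hX : ∀ w, ∑ a, q w a * X (w ++ [a]) ≤ X w)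
    {C : ℝ} (hC : ∀ w a, |X (w ++ [a]) - X w| ≤ C) {l : ℝ} (hl : 0 ≤ l) (hlC : l * C ≤ 1) :
    IsSupermartingale q fun w => Real.exp (l * X w - (l * C) ^ 2 * w.length) where
  pos _ := Real.exp_pos _
  sum_le w := by
    set d : Ω → ℝ := fun a => X (w ++ [a]) - X w with hd
    have hdrift : ∑ a, q w a * d a ≤ 0 := by
      simp only [hd, mul_sub, Finset.sum_sub_distrib, ← Finset.sum_mul, hq.sum_eq_one, one_mul]
      exact sub_nonpos.2 (hX w)
    have hexp (a : Ω) : Real.exp (l * d a) ≤ 1 + l * d a + (l * C) ^ 2 := by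
      have habs : |l * d a| ≤ l * C := by
        rw [abs_mul, abs_of_nonneg hl]
        exact mul_le_mul_of_nonneg_left (hC w a) hl
      have hquad := (abs_le.1 (Real.abs_exp_sub_one_sub_id_le (habs.trans hlC))).2
      have hsq : (l * d a) ^ 2 ≤ (l * C) ^ 2 := sq_le_sq' (abs_le.1 habs).1 (abs_le.1 habs).2
      linarith
    have hmgf : ∑ a, q w a * Real.exp (l * d a) ≤ Real.exp ((l * C) ^ 2) :=
      calc ∑ a, q w a * Real.exp (l * d a)
          ≤ ∑ a, q w a * (1 + l * d a + (l * C) ^ 2) :=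
            Finset.sum_le_sum fun a _ => mul_le_mul_of_nonneg_left (hexp a) (hq.pos w a).le
        _ = (∑ a, q w a) * (1 + (l * C) ^ 2) + l * ∑ a, q w a * d a := by
            rw [Finset.sum_mul, Finset.mul_sum, ← Finset.sum_add_distrib]
            exact Finset.sum_congr rfl fun a _ => by ring
        _ ≤ (l * C) ^ 2 + 1 := by
            rw [hq.sum_eq_one]
            linarith [mul_nonpos_of_nonneg_of_nonpos hl hdrift]
        _ ≤ Real.exp ((l * C) ^ 2) := Real.add_one_le_exp _
    calc ∑ a, q w a * Real.exp (l * X (w ++ [a]) - (l * C) ^ 2 * (w ++ [a]).length)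
        = (∑ a, q w a * Real.exp (l * d a)) *
            Real.exp (l * X w - (l * C) ^ 2 * w.length - (l * C) ^ 2) := by
          rw [Finset.sum_mul]
          refine Finset.sum_congr rfl fun a _ => ?_
          rw [mul_assoc, ← Real.exp_add, List.length_append, List.length_singleton, hd]
          push_cast
          ring_nf
      _ ≤ Real.exp ((l * C) ^ 2) * Real.exp (l * X w - (l * C) ^ 2 * w.length - (l * C) ^ 2) := by
          gcongr
      _ = Real.exp (l * X w - (l * C) ^ 2 * w.length) := by
          rw [← Real.exp_add, add_sub_cancel]

section Family

variable {U : ℕ → List Ω → ℝ}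

theorem summable_comp_take (hU : ∀ n, IsSupermartingale q (U n)) (hq : IsPredictor q)
    (hsum : Summable fun n => U n []) (w : List Ω) : Summable fun n => U n (w.take n) := by
  refine Summable.of_nonneg_of_le (fun n => ((hU n).pos _).le) (fun n => ?_)
    (hsum.mul_left (wordProb q w)⁻¹)
  rw [← div_eq_inv_mul, le_div_iff₀' (hq.wordProb_pos w)]
  simpa using ((hU n).comp_take hq n).wordProb_mul_le hq w

theorem tsum_comp_take (hU : ∀ n, IsSupermartingale q (U n)) (hq : IsPredictor q)
    (hsum : Summable fun n => U n []) :
    IsSupermartingale q fun w => ∑' n, U n (w.take n) where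
  pos w := (summable_comp_take hU hq hsum w).tsum_pos (fun n => ((hU n).pos _).le) 0
    ((hU 0).pos _)
  sum_le w := by
    have hs := summable_comp_take hU hq hsum
    simp only [← tsum_mul_left]
    rw [← Summable.tsum_finsetSum fun a _ => (hs _).mul_left _]
    exact Summable.tsum_le_tsum (fun n => ((hU n).comp_take hq n).sum_le w)
      (summable_sum fun a _ => (hs _).mul_left _) (hs w)

theorem tendsto_tsum_comp_take (hU : ∀ n, IsSupermartingale q (U n)) (hq : IsPredictor q)
    (hsum : Summable fun n => U n []) {ω : ℕ → Ω} (hω : ∃ᶠ n in atTop, 1 ≤ U n (pre ω n)) :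
    Tendsto (fun N => ∑' n, U n ((pre ω N).take n)) atTop atTop := by
  refine tendsto_atTop.2 fun b => ?_
  obtain ⟨c, hc⟩ := exists_nat_ge b
  obtain ⟨t, ht, htc⟩ := (Nat.frequently_atTop_iff_infinite.1 hω).exists_subset_card_eq c
  filter_upwards [eventually_ge_atTop (t.sup id)] with N hN
  calc b ≤ t.card • (1 : ℝ) := by rwa [htc, nsmul_one]
    _ ≤ ∑ n ∈ t, U n ((pre ω N).take n) := Finset.card_nsmul_le_sum _ _ _ fun n hn => by
        rw [take_pre ω (m := n) ((Finset.le_sup (f := id) hn).trans hN)]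
        exact ht hn
    _ ≤ ∑' n, U n ((pre ω N).take n) :=
        (summable_comp_take hU hq hsum _).sum_le_tsum t fun n _ => ((hU n).pos _).le

end Family

end IsSupermartingale

/-- Skeptic can force the event `E` against the predictor `q`: some positive supermartingale
tends to infinity along every sequence outside `E`. -/
def CanForce (q : List Ω → Ω → ℝ) (E : (ℕ → Ω) → Prop) : Prop :=
  ∃ F, IsSupermartingale q F ∧ ∀ ω, ¬ E ω → Tendsto (fun n => F (pre ω n)) atTop atTop

namespace CanForce

variable {D E : (ℕ → Ω) → Prop}

theorem mono (hD : CanForce q D) (h : ∀ ω, D ω → E ω) : CanForce q E := by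
  obtain ⟨F, hF, hlim⟩ := hD
  exact ⟨F, hF, fun ω hω => hlim ω (mt (h ω) hω)⟩

theorem and (hD : CanForce q D) (hE : CanForce q E) : CanForce q fun ω => D ω ∧ E ω := by
  obtain ⟨F, hF, hFlim⟩ := hD
  obtain ⟨G, hG, hGlim⟩ := hE
  refine ⟨fun w => F w + G w, hF.add hG, fun ω hω => ?_⟩
  rcases not_and_or.1 hω with hω | hω
  · exact tendsto_atTop_mono (fun n => le_add_of_nonneg_right (hG.pos _).le) (hFlim ω hω)
  · exact tendsto_atTop_mono (fun n => le_add_of_nonneg_left (hF.pos _).le) (hGlim ω hω)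

/-- Skeptic invests `U n []` in the `n`-th supermartingale and stops it
at time `n`. -/
theorem eventually_lt_one {U : ℕ → List Ω → ℝ} (hU : ∀ n, IsSupermartingale q (U n))
    (hq : IsPredictor q) (hsum : Summable fun n => U n []) :
    CanForce q fun ω => ∀ᶠ n in atTop, U n (pre ω n) < 1 := by
  refine ⟨_, IsSupermartingale.tsum_comp_take hU hq hsum, fun ω hω =>
    IsSupermartingale.tendsto_tsum_comp_take hU hq hsum ?_⟩
  simpa only [not_eventually, not_lt] using hω

theorem eventually_log_le {U : ℕ → List Ω → ℝ} (hU : ∀ n, IsSupermartingale q (U n))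
    (hq : IsPredictor q) (hone : ∀ n, U n [] = 1) :
    CanForce q fun ω => ∀ᶠ n : ℕ in atTop, Real.log (U n (pre ω n)) ≤ 2 * Real.log (n + 1) := by
  have hsum : Summable fun n : ℕ => (((n : ℝ) + 1) ^ 2)⁻¹ * U n [] := by
    simpa [hone] using (summable_nat_add_iff 1).2 (Real.summable_nat_pow_inv.2 one_lt_two)
  refine (eventually_lt_one (fun n => (hU n).const_mul (by positivity)) hq hsum).mono
    fun ω hω => hω.mono fun n hn => ?_
  rw [inv_mul_lt_one₀ (by positivity)] at hn
  exact (Real.log_le_log ((hU n).pos _) hn.le).trans_eq (by rw [Real.log_pow]; norm_num)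

theorem eventually_log_wordProb_le {r : List Ω → Ω → ℝ} (hr : IsPredictor r)
    (hq : IsPredictor q) :
    CanForce q fun ω => ∀ᶠ n : ℕ in atTop,
      Real.log (wordProb r (pre ω n)) ≤ Real.log (wordProb q (pre ω n)) + 2 * Real.log (n + 1) := by
  refine (eventually_log_le (fun _ => IsSupermartingale.wordProb_div hr hq) hq (by simp)).mono
    fun ω hω => hω.mono fun n hn => ?_
  rw [Real.log_div (hr.wordProb_pos _).ne' (hq.wordProb_pos _).ne'] at hn
  linarith

theorem eventually_le_sqrt_mul_log (hq : IsPredictor q) {X : List Ω → ℝ} (hX0 : X [] = 0)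
    (hX : ∀ w, ∑ a, q w a * X (w ++ [a]) ≤ X w) {C : ℝ} (hC0 : 0 < C)
    (hC : ∀ w a, |X (w ++ [a]) - X w| ≤ C) :
    CanForce q fun ω => ∀ᶠ n : ℕ in atTop,
      X (pre ω n) ≤ C * (√(n + 1) * (1 + 2 * Real.log (n + 1))) := by
  set l : ℕ → ℝ := fun n => 1 / (C * √(n + 1)) with hl
  have hlC (n : ℕ) : l n * C = 1 / √(n + 1) := by simp only [hl]; field_simp
  have hlC_le (n : ℕ) : l n * C ≤ 1 := by
    rw [hlC, div_le_one (by positivity)]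
    exact Real.one_le_sqrt.2 (le_add_of_nonneg_left n.cast_nonneg)
  refine (eventually_log_le (fun n => IsSupermartingale.exp hq hX hC (by positivity) (hlC_le n)) hq
    (by simp [hX0])).mono fun ω hω => hω.mono fun n hn => ?_
  have hcomp : (l n * C) ^ 2 * n ≤ 1 := by
    rw [hlC, div_pow, one_pow, Real.sq_sqrt (by positivity), one_div_mul_eq_div,
      div_le_one (by positivity)]
    exact le_add_of_nonneg_right zero_le_one
  rw [Real.log_exp, length_pre] at hn
  have hlX : l n * X (pre ω n) ≤ 1 + 2 * Real.log (n + 1) := by linarith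
  rw [hl, one_div_mul_eq_div, div_le_iff₀ (by positivity)] at hlX
  linarith

end CanForce

theorem isLittleO_sqrt_mul_log :
    (fun n : ℕ => √((n : ℝ) + 1) * (1 + 2 * Real.log (n + 1))) =o[atTop] fun n : ℕ => (n : ℝ) := by
  have hlog : (fun x : ℝ => 1 + 2 * Real.log x) =o[atTop] fun x => √x := by
    simp only [Real.sqrt_eq_rpow]
    refine IsLittleO.add (isLittleO_const_left.2 (Or.inr ?_))
      ((isLittleO_log_rpow_atTop (by norm_num)).const_mul_left 2)
    exact tendsto_norm_atTop_atTop.comp (tendsto_rpow_atTop (by norm_num))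
  have hreal : (fun x : ℝ => √x * (1 + 2 * Real.log x)) =o[atTop] id := by
    refine ((isBigO_refl _ _).mul_isLittleO hlog).congr' EventuallyEq.rfl ?_
    filter_upwards [eventually_ge_atTop 0] with x hx using Real.mul_self_sqrt hx
  have hshift : Tendsto (fun n : ℕ => (n : ℝ) + 1) atTop atTop :=
    tendsto_natCast_atTop_atTop.atTop_add tendsto_const_nhds
  refine (hreal.comp_tendsto hshift).trans_isBigO (IsBigO.of_bound 2 ?_)
  filter_upwards [eventually_ge_atTop 1] with n hn
  have : (1 : ℝ) ≤ n := Nat.one_le_cast.2 hn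
  simp only [Function.comp_apply, id, Real.norm_eq_abs, Nat.abs_cast]
  rw [abs_of_nonneg (by positivity)]
  linarith

theorem isLittleO_log_succ :
    (fun n : ℕ => 2 * Real.log ((n : ℝ) + 1)) =o[atTop] fun n : ℕ => (n : ℝ) := by
  refine IsBigO.trans_isLittleO (IsBigO.of_bound 1 (Eventually.of_forall fun n => ?_))
    isLittleO_sqrt_mul_log
  have hlog : 0 ≤ Real.log ((n : ℝ) + 1) := Real.log_nonneg (by simp)
  have hsqrt : 1 ≤ √((n : ℝ) + 1) := Real.one_le_sqrt.2 (by simp)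
  rw [Real.norm_of_nonneg (by positivity), Real.norm_of_nonneg (by positivity)]
  nlinarith

theorem CanForce.isLittleO_of_martingale (hq : IsPredictor q) {X : List Ω → ℝ} (hX0 : X [] = 0)
    (hX : ∀ w, ∑ a, q w a * X (w ++ [a]) = X w) {C : ℝ} (hC0 : 0 < C)
    (hC : ∀ w a, |X (w ++ [a]) - X w| ≤ C) :
    CanForce q fun ω => (fun n => X (pre ω n)) =o[atTop] fun n : ℕ => (n : ℝ) := by
  have hupper := eventually_le_sqrt_mul_log hq hX0 (fun w => (hX w).le) hC0 hC
  have hlower := eventually_le_sqrt_mul_log hq (X := fun w => -X w) (by simp [hX0])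
    (fun w => by simp [hX]) hC0 fun w a => by rw [neg_sub_neg, abs_sub_comm]; exact hC w a
  refine (hupper.and hlower).mono fun ω ⟨hle, hge⟩ =>
    IsBigO.trans_isLittleO (IsBigO.of_bound C ?_) isLittleO_sqrt_mul_log
  filter_upwards [hle, hge] with n hle hge
  exact (abs_le.2 ⟨by linarith, hle⟩).trans
    (mul_le_mul_of_nonneg_left (le_abs_self _) hC0.le)

end Supermartingale

/-! ## Finite-state sources -/

section LinearAlgebra

theorem range_eq_ker_of_finrank_ker_le_one {K V : Type*} [Field K] [AddCommGroup V] [Module K V]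
    [FiniteDimensional K V] {T : V →ₗ[K] V} {φ : Module.Dual K V} (hφ : φ ≠ 0)
    (hφT : φ ∘ₗ T = 0) (hT : Module.finrank K (LinearMap.ker T) ≤ 1) :
    LinearMap.range T = LinearMap.ker φ := by
  refine Submodule.eq_of_le_of_finrank_le (LinearMap.range_le_ker_iff.2 hφT) ?_
  have hrank := LinearMap.finrank_range_add_finrank_ker T
  have hcorank := Module.Dual.finrank_ker_add_one_of_ne_zero hφ
  omega

end LinearAlgebra

/-- A unifilar source with states `S`: in the state `s` it emits the letter `a` with probability
`prob s a`, and the emitted letter determines the next state `step s a`. -/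
structure UnifilarSource (S Ω : Type*) [Fintype Ω] where
  step : S → Ω → S
  prob : S → Ω → ℝ
  prob_pos : ∀ s a, 0 < prob s a
  sum_prob : ∀ s, ∑ a, prob s a = 1

namespace UnifilarSource

variable {S Ω : Type*} [Fintype Ω] (P : UnifilarSource S Ω)

/-- The conditional probabilities of the letters emitted by the source when it starts in `s`. -/
def predictor (s : S) (w : List Ω) (a : Ω) : ℝ :=
  P.prob (w.foldl P.step s) a

theorem isPredictor_predictor (s : S) : IsPredictor (P.predictor s) where
  pos _ := P.prob_pos _
  sum_eq_one _ := P.sum_prob _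

theorem predictor_append (s : S) (u : List Ω) :
    (fun w => P.predictor s (u ++ w)) = P.predictor (u.foldl P.step s) := by
  funext w a
  rw [predictor, predictor, List.foldl_append]

/-- The entropy of the next letter, as a function of the state. -/
noncomputable def entropy (s : S) : ℝ :=
  ∑ a, Real.negMulLog (P.prob s a)

/-- The Markov operator of the source, mapping `g` to the expectation of `g` at the next state. -/
def expect : (S → ℝ) →ₗ[ℝ] S → ℝ where
  toFun g s := ∑ a, P.prob s a * g (P.step s a)
  map_add' g h := by
    ext s
    simp only [Pi.add_apply, mul_add, Finset.sum_add_distrib]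
  map_smul' c g := by
    ext s
    simp only [Pi.smul_apply, smul_eq_mul, RingHom.id_apply, Finset.mul_sum, mul_left_comm]

theorem expect_apply (g : S → ℝ) (s : S) :
    P.expect g s = ∑ a, P.prob s a * g (P.step s a) := rfl

theorem expect_const (c : ℝ) (s : S) : P.expect (fun _ => c) s = c := by
  rw [expect_apply, ← Finset.sum_mul, P.sum_prob, one_mul]

/-- Irreducibility: every state can be reached from every other one. -/
def IsIrreducible : Prop :=
  ∀ s t, ∃ w : List Ω, w.foldl P.step s = t

/-- Invariance of the weights `π` with total mass `1` under the Markov operator. -/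
structure IsInvariant [Fintype S] (π : S → ℝ) : Prop where
  sum_eq_one : ∑ s, π s = 1
  dotProduct_expect : ∀ g, π ⬝ᵥ P.expect g = π ⬝ᵥ g

variable {P}

theorem apply_step_eq_of_isMax {g : S → ℝ} {s : S} (hg : P.expect g s = g s)
    (hmax : ∀ t, g t ≤ g s) (a : Ω) : g (P.step s a) = g s := by
  have hgap : ∑ a, P.prob s a * (g s - g (P.step s a)) = 0 := by
    simp only [mul_sub, Finset.sum_sub_distrib, ← Finset.sum_mul, P.sum_prob, one_mul,
      ← expect_apply, hg, sub_self]
  have hnonneg : ∀ a ∈ Finset.univ, 0 ≤ P.prob s a * (g s - g (P.step s a)) := fun a _ =>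
    mul_nonneg (P.prob_pos s a).le (sub_nonneg.2 (hmax _))
  have hzero := (Finset.sum_eq_zero_iff_of_nonneg hnonneg).1 hgap a (Finset.mem_univ a)
  exact (sub_eq_zero.1 ((mul_eq_zero.1 hzero).resolve_left (P.prob_pos s a).ne')).symm

theorem apply_foldl_step_eq_of_isMax {g : S → ℝ} (hg : P.expect g = g) {s : S}
    (hmax : ∀ t, g t ≤ g s) (w : List Ω) : g (w.foldl P.step s) = g s := by
  induction w using List.reverseRecOn with
  | nil => rfl
  | append_singleton w a ih =>
    rw [List.foldl_append, List.foldl_cons, List.foldl_nil,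
      apply_step_eq_of_isMax (congrFun hg _) (fun t => (hmax t).trans_eq ih.symm), ih]

theorem IsIrreducible.apply_eq_of_expect_eq [Finite S] (hP : P.IsIrreducible) {g : S → ℝ}
    (hg : P.expect g = g) (s t : S) : g s = g t := by
  have : Nonempty S := ⟨s⟩
  obtain ⟨r, hmax⟩ := Finite.exists_max g
  obtain ⟨u, rfl⟩ := hP r s
  obtain ⟨v, rfl⟩ := hP r t
  rw [apply_foldl_step_eq_of_isMax hg hmax, apply_foldl_step_eq_of_isMax hg hmax]

theorem IsIrreducible.finrank_ker_id_sub_expect_le_one [Finite S] (hP : P.IsIrreducible) :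
    Module.finrank ℝ (LinearMap.ker (LinearMap.id - P.expect)) ≤ 1 := by
  have hone : (fun _ => 1 : S → ℝ) ∈ LinearMap.ker (LinearMap.id - P.expect) := by
    ext s
    simp [P.expect_const]
  refine finrank_le_one ⟨_, hone⟩ fun ⟨g, hg⟩ => ?_
  have hconst := hP.apply_eq_of_expect_eq (sub_eq_zero.1 hg).symm
  rcases isEmpty_or_nonempty S with hS | ⟨⟨s⟩⟩
  · exact ⟨0, Subsingleton.elim _ _⟩
  · exact ⟨g s, Subtype.ext <| funext fun t => by simp [hconst s t]⟩

theorem IsIrreducible.exists_poisson [Fintype S] (hP : P.IsIrreducible) {π : S → ℝ}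
    (hπ : P.IsInvariant π) (f : S → ℝ) :
    ∃ g : S → ℝ, ∀ s, f s - π ⬝ᵥ f = g s - P.expect g s := by
  set φ : Module.Dual ℝ (S → ℝ) := dotProductBilin ℝ ℝ π with hφ
  have hφ_const (c : ℝ) : φ (fun _ => c) = c := by
    simp [hφ, dotProduct, ← Finset.sum_mul, hπ.sum_eq_one]
  have hφ_ne : φ ≠ 0 := fun h => one_ne_zero ((hφ_const 1).symm.trans (by rw [h]; rfl))
  have hφ_comp : φ ∘ₗ (LinearMap.id - P.expect) = 0 := by
    ext1 g
    simp [hφ, hπ.dotProduct_expect]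
  have hmem : (f - fun _ => π ⬝ᵥ f) ∈ LinearMap.ker φ := by
    rw [LinearMap.mem_ker, map_sub, hφ_const]
    exact sub_self _
  rw [← range_eq_ker_of_finrank_ker_le_one hφ_ne hφ_comp hP.finrank_ker_id_sub_expect_le_one]
    at hmem
  obtain ⟨g, hg⟩ := hmem
  exact ⟨g, fun s => (congrFun hg s).symm⟩

/-- The process `-log P(w) - |w| H` together with its correction by a solution `g` of the Poisson
equation. -/
noncomputable def correctedSurprisal (P : UnifilarSource S Ω) (s₀ : S) (H : ℝ) (g : S → ℝ)
    (w : List Ω) : ℝ :=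
  -Real.log (wordProb (P.predictor s₀) w) - w.length * H + (g (w.foldl P.step s₀) - g s₀)

theorem correctedSurprisal_append_singleton (s₀ : S) (H : ℝ) (g : S → ℝ) (w : List Ω) (a : Ω) :
    P.correctedSurprisal s₀ H g (w ++ [a]) = P.correctedSurprisal s₀ H g w +
      (-Real.log (P.prob (w.foldl P.step s₀) a) - H +
        (g (P.step (w.foldl P.step s₀) a) - g (w.foldl P.step s₀))) := by
  have hP := P.isPredictor_predictor s₀
  rw [correctedSurprisal, correctedSurprisal, wordProb_append_singleton,
    Real.log_mul (hP.wordProb_pos w).ne' (hP.pos w a).ne', predictor, List.foldl_append]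
  simp only [List.length_append, List.length_singleton, List.foldl_cons, List.foldl_nil]
  push_cast
  ring

theorem sum_predictor_mul_correctedSurprisal {H : ℝ} {g : S → ℝ}
    (hg : ∀ s, P.entropy s - H = g s - P.expect g s) (s₀ : S) (w : List Ω) :
    ∑ a, P.predictor s₀ w a * P.correctedSurprisal s₀ H g (w ++ [a]) =
      P.correctedSurprisal s₀ H g w := by
  set s := w.foldl P.step s₀ with hs
  calc ∑ a, P.predictor s₀ w a * P.correctedSurprisal s₀ H g (w ++ [a])
      = (∑ a, P.prob s a) * (P.correctedSurprisal s₀ H g w - H - g s) + P.entropy s +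
          P.expect g s := by
        simp only [entropy, expect_apply, Finset.sum_mul, ← Finset.sum_add_distrib]
        refine Finset.sum_congr rfl fun a _ => ?_
        rw [correctedSurprisal_append_singleton, predictor, ← hs, Real.negMulLog]
        ring
    _ = P.correctedSurprisal s₀ H g w := by
        rw [P.sum_prob]
        linarith [hg s]

theorem exists_abs_correctedSurprisal_sub_le [Finite S] (s₀ : S) (H : ℝ) (g : S → ℝ) :
    ∃ C > 0, ∀ w a,
      |P.correctedSurprisal s₀ H g (w ++ [a]) - P.correctedSurprisal s₀ H g w| ≤ C := by
  obtain ⟨C, hC⟩ := (Set.finite_range fun x : S × Ω =>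
    |-Real.log (P.prob x.1 x.2) - H + (g (P.step x.1 x.2) - g x.1)|).bddAbove
  refine ⟨max C 1, by positivity, fun w a => ?_⟩
  rw [correctedSurprisal_append_singleton, add_sub_cancel_left]
  exact (hC ⟨(w.foldl P.step s₀, a), rfl⟩).trans (le_max_left _ _)

theorem IsIrreducible.canForce_neg_log_wordProb_sub [Fintype S] (hP : P.IsIrreducible) {π : S → ℝ}
    (hπ : P.IsInvariant π) (s₀ : S) :
    CanForce (P.predictor s₀) fun ω =>
      (fun n : ℕ => -Real.log (wordProb (P.predictor s₀) (pre ω n)) - n * (π ⬝ᵥ P.entropy))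
        =o[atTop] fun n : ℕ => (n : ℝ) := by
  obtain ⟨g, hg⟩ := hP.exists_poisson hπ P.entropy
  obtain ⟨C, hC0, hC⟩ := P.exists_abs_correctedSurprisal_sub_le s₀ (π ⬝ᵥ P.entropy) g
  refine (CanForce.isLittleO_of_martingale (P.isPredictor_predictor s₀)
    (by simp [correctedSurprisal]) (sum_predictor_mul_correctedSurprisal hg s₀) hC0 hC).mono
      fun ω hω => ?_
  obtain ⟨B, hB⟩ := (Set.finite_range fun s => |g s - g s₀|).bddAbove
  have hbdd : (fun n => g ((pre ω n).foldl P.step s₀) - g s₀) =o[atTop] fun n : ℕ => (n : ℝ) :=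
    (IsBigO.of_bound B (Eventually.of_forall fun n => by simpa using hB ⟨_, rfl⟩)).trans_isLittleO
      ((isLittleO_const_id_atTop (1 : ℝ)).comp_tendsto tendsto_natCast_atTop_atTop)
  refine (hω.sub hbdd).congr_left fun n => ?_
  rw [correctedSurprisal, length_pre, add_sub_cancel_right]

end UnifilarSource

/-! ## Ziv's inequality -/

theorem sum_log_le_card_mul_log {ι : Type*} {X : Finset ι} {y : ι → ℝ} (hy : ∀ x ∈ X, 0 < y x)
    {B : ℝ} (hB : ∑ x ∈ X, y x ≤ B) :
    ∑ x ∈ X, Real.log (y x) ≤ X.card * Real.log (B / X.card) := by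
  rcases X.eq_empty_or_nonempty with rfl | hX
  · simp
  have hcard : (0 : ℝ) < X.card := Nat.cast_pos.2 hX.card_pos
  have hjensen : ∑ x ∈ X, (X.card : ℝ)⁻¹ * Real.log (y x) ≤
      Real.log (∑ x ∈ X, (X.card : ℝ)⁻¹ * y x) :=
    strictConcaveOn_log_Ioi.concaveOn.le_map_sum (fun _ _ => by positivity)
      (by simp [hcard.ne']) hy
  rw [← Finset.mul_sum, ← Finset.mul_sum, inv_mul_le_iff₀ hcard] at hjensen
  refine hjensen.trans (mul_le_mul_of_nonneg_left (Real.log_le_log ?_ ?_) hcard.le)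
  · exact mul_pos (inv_pos.2 hcard) (Finset.sum_pos hy hX)
  · rw [inv_mul_eq_div]
    gcongr

namespace UnifilarSource

variable {S Ω : Type*} [Fintype S] [Fintype Ω] (P : UnifilarSource S Ω)

theorem sum_wordProb_pos (s : S) (w : List Ω) : 0 < ∑ t, wordProb (P.predictor t) w :=
  Finset.sum_pos (fun t _ => (P.isPredictor_predictor t).wordProb_pos w) ⟨s, Finset.mem_univ s⟩

/-- Summing over the unknown states in which the source enters the phrases decouples the
phrases. -/
theorem log_wordProb_flatten_le (s : S) (ph : List (List Ω)) :
    Real.log (wordProb (P.predictor s) ph.flatten) ≤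
      (ph.map fun x => Real.log (∑ t, wordProb (P.predictor t) x)).sum := by
  induction ph generalizing s with
  | nil => simp
  | cons x ph ih =>
    have hpos (t : S) (w : List Ω) := (P.isPredictor_predictor t).wordProb_pos w
    rw [List.flatten_cons, wordProb_append, P.predictor_append,
      Real.log_mul (hpos _ _).ne' (hpos _ _).ne', List.map_cons, List.sum_cons]
    refine add_le_add (Real.log_le_log (hpos _ _) ?_) (ih _)
    exact Finset.single_le_sum (f := fun t => wordProb (P.predictor t) x)
      (fun t _ => (hpos t x).le) (Finset.mem_univ s)

theorem sum_pow_length_mul_sum_wordProb_le {θ : ℝ} (hθ : 0 ≤ θ) (hθ' : θ < 1)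
    (X : Finset (List Ω)) :
    ∑ x ∈ X, θ ^ x.length * ∑ t, wordProb (P.predictor t) x ≤ Fintype.card S * (1 - θ)⁻¹ := by
  simp only [Finset.mul_sum]
  rw [Finset.sum_comm, ← nsmul_eq_mul]
  exact Finset.sum_le_card_nsmul _ _ _ fun t _ =>
    (P.isPredictor_predictor t).sum_pow_length_mul_wordProb_le hθ hθ' X

theorem log_wordProb_flatten_le_of_nodup (s : S) {ph : List (List Ω)} (hph : ph.Nodup) {θ : ℝ}
    (hθ : 0 < θ) (hθ' : θ < 1) :
    Real.log (wordProb (P.predictor s) ph.flatten) ≤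
      ph.length * Real.log (Fintype.card S * (1 - θ)⁻¹ / ph.length) -
        ph.flatten.length * Real.log θ := by
  classical
  have hpos := P.sum_wordProb_pos s
  have hterm (x : List Ω) : Real.log (∑ t, wordProb (P.predictor t) x) =
      Real.log (θ ^ x.length * ∑ t, wordProb (P.predictor t) x) - x.length * Real.log θ := by
    rw [Real.log_mul (by positivity) (hpos x).ne', Real.log_pow, add_sub_cancel_left]
  have hlength : ∑ x ∈ ph.toFinset, (x.length : ℝ) = ph.flatten.length := by
    rw [List.length_flatten, ← List.sum_toFinset _ hph, Nat.cast_sum]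
  calc Real.log (wordProb (P.predictor s) ph.flatten)
      ≤ ∑ x ∈ ph.toFinset, Real.log (∑ t, wordProb (P.predictor t) x) :=
        (P.log_wordProb_flatten_le s ph).trans_eq (List.sum_toFinset _ hph).symm
    _ = ∑ x ∈ ph.toFinset, Real.log (θ ^ x.length * ∑ t, wordProb (P.predictor t) x) -
          ph.flatten.length * Real.log θ := by
        simp only [hterm, Finset.sum_sub_distrib, ← Finset.sum_mul, hlength]
    _ ≤ _ := by
        rw [← List.toFinset_card_of_nodup hph]
        exact sub_le_sub_right (sum_log_le_card_mul_log
          (fun x _ => mul_pos (pow_pos hθ _) (hpos x))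
          (P.sum_pow_length_mul_sum_wordProb_le hθ.le hθ' _)) _

end UnifilarSource

/-! ## The Lempel–Ziv predictor -/

section LempelZiv

variable {Ω : Type*}

/-- Only boundedly many distinct words are shorter than `L`. -/
theorem exists_mul_length_le_length_flatten_add [Finite Ω] (L : ℕ) :
    ∃ B : ℕ, ∀ ph : List (List Ω), ph.Nodup → L * ph.length ≤ ph.flatten.length + B := by
  classical
  have hfin := List.finite_length_lt Ω L
  refine ⟨hfin.toFinset.card * L, fun ph hph => ?_⟩
  have hshort : {x ∈ ph.toFinset | x.length < L} ⊆ hfin.toFinset := fun x hx => by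
    simpa using (Finset.mem_filter.1 hx).2
  calc L * ph.length
      = ∑ _x ∈ ph.toFinset, L := by
        rw [Finset.sum_const, List.toFinset_card_of_nodup hph, smul_eq_mul, mul_comm]
    _ ≤ ∑ x ∈ ph.toFinset, (x.length + if x.length < L then L else 0) :=
        Finset.sum_le_sum fun _ _ => by split_ifs <;> omega
    _ = ph.flatten.length + {x ∈ ph.toFinset | x.length < L}.card * L := by
        rw [Finset.sum_add_distrib, List.sum_toFinset _ hph, ← List.length_flatten,
          ← Finset.sum_filter, Finset.sum_const, smul_eq_mul]
    _ ≤ ph.flatten.length + hfin.toFinset.card * L := by gcongr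

variable [DecidableEq Ω]

theorem parse_append_singleton_of_mem {w : List Ω} {a : Ω}
    (h : (parse w).2 ++ [a] ∈ (parse w).1) :
    parse (w ++ [a]) = ((parse w).1, (parse w).2 ++ [a]) := by
  rw [parse, List.foldl_append]
  exact if_pos h

theorem parse_append_singleton_of_notMem {w : List Ω} {a : Ω}
    (h : (parse w).2 ++ [a] ∉ (parse w).1) :
    parse (w ++ [a]) = ((parse w).1 ++ [(parse w).2 ++ [a]], []) := by
  rw [parse, List.foldl_append]
  exact if_neg h

theorem flatten_parse_append (w : List Ω) : (parse w).1.flatten ++ (parse w).2 = w := by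
  induction w using List.reverseRecOn with
  | nil => rfl
  | append_singleton w a ih =>
    conv_rhs => rw [← ih]
    by_cases h : (parse w).2 ++ [a] ∈ (parse w).1
    · simp [parse_append_singleton_of_mem h]
    · simp [parse_append_singleton_of_notMem h]

theorem nodup_parse (w : List Ω) : (parse w).1.Nodup := by
  induction w using List.reverseRecOn with
  | nil => exact List.nodup_nil
  | append_singleton w a ih =>
    by_cases h : (parse w).2 ++ [a] ∈ (parse w).1
    · rwa [parse_append_singleton_of_mem h]
    · rw [parse_append_singleton_of_notMem h, ← List.concat_eq_append]
      exact ih.concat h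

theorem parse_snd_mem (w : List Ω) : (parse w).2 ∈ [] :: (parse w).1 := by
  obtain rfl | ⟨w, a, rfl⟩ := w.eq_nil_or_concat'
  · simp [parse]
  · by_cases h : (parse w).2 ++ [a] ∈ (parse w).1
    · simp [parse_append_singleton_of_mem h, h]
    · simp [parse_append_singleton_of_notMem h]

theorem length_flatten_parse_le (w : List Ω) : (parse w).1.flatten.length ≤ w.length := by
  conv_rhs => rw [← flatten_parse_append w, List.length_append]
  exact Nat.le_add_right _ _

theorem isLittleO_length_parse [Finite Ω] (ω : ℕ → Ω) :
    (fun n => ((parse (pre ω n)).1.length : ℝ)) =o[atTop] fun n : ℕ => (n : ℝ) := by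
  refine isLittleO_iff.2 fun c hc => ?_
  obtain ⟨L, hL⟩ := exists_nat_gt (2 / c)
  obtain ⟨B, hB⟩ := exists_mul_length_le_length_flatten_add (Ω := Ω) L
  filter_upwards [eventually_ge_atTop B] with n hn
  have hlength : L * (parse (pre ω n)).1.length ≤ 2 * n :=
    calc L * (parse (pre ω n)).1.length
        ≤ (parse (pre ω n)).1.flatten.length + B := hB _ (nodup_parse _)
      _ ≤ n + n := add_le_add ((length_flatten_parse_le _).trans_eq (length_pre ω n)) hn
      _ = 2 * n := (two_mul n).symm
  have hlength' : (L : ℝ) * (parse (pre ω n)).1.length ≤ 2 * n := mod_cast hlength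
  rw [Real.norm_natCast, Real.norm_natCast]
  refine le_of_mul_le_mul_left ?_ (div_pos two_pos hc)
  calc 2 / c * (parse (pre ω n)).1.length
      ≤ L * (parse (pre ω n)).1.length := by gcongr
    _ ≤ 2 / c * (c * n) := by rwa [← mul_assoc, div_mul_cancel₀ _ hc.ne']

variable [Fintype Ω]

theorem append_singleton_mem_candidates {l : List (List Ω)} {x : List Ω} {a : Ω}
    (hx : x ∈ [] :: l) (hxa : x ++ [a] ∉ l) : x ++ [a] ∈ candidates l := by
  refine Finset.mem_filter.2 ⟨Finset.mem_image.2 ⟨(x, a), ?_, rfl⟩, by simpa using hxa⟩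
  exact Finset.mk_mem_product (List.mem_toFinset.2 hx) (Finset.mem_univ a)

theorem notMem_candidates {l : List (List Ω)} {x : List Ω} (hx : x ∈ [] :: l) :
    x ∉ candidates l :=
  fun h => (Finset.mem_filter.1 h).2 hx

theorem card_candidates_le (l : List (List Ω)) :
    (candidates l).card ≤ Fintype.card Ω * (l.length + 1) := by
  refine (Finset.card_filter_le _ _).trans (Finset.card_image_le.trans ?_)
  rw [Finset.card_product, mul_comm]
  exact Nat.mul_le_mul le_rfl (List.toFinset_card_le _)

theorem numCandidates_le (w x : List Ω) :
    numCandidates w x ≤ Fintype.card Ω * ((parse w).1.length + 1) :=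
  (Finset.card_filter_le _ _).trans (card_candidates_le _)

theorem numCandidates_append_of_mem {w : List Ω} {a : Ω}
    (h : (parse w).2 ++ [a] ∈ (parse w).1) (x : List Ω) :
    numCandidates (w ++ [a]) x = numCandidates w x := by
  rw [numCandidates, numCandidates, parse_append_singleton_of_mem h]

/-- A longest phrase with the prefix `x` can be extended to a candidate by any letter. -/
theorem numCandidates_pos [Nonempty Ω] {w x : List Ω} (hx : x ∈ [] :: (parse w).1) :
    0 < numCandidates w x := by
  obtain ⟨y, hy, hmax⟩ := Finset.exists_max_image {y ∈ ([] :: (parse w).1).toFinset | x <+: y}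
    List.length ⟨x, by simpa using hx⟩
  simp only [Finset.mem_filter, List.mem_toFinset] at hy hmax
  obtain ⟨a⟩ := ‹Nonempty Ω›
  have hprefix : x <+: y ++ [a] := hy.2.trans (List.prefix_append _ _)
  refine Finset.card_pos.2 ⟨y ++ [a], Finset.mem_filter.2
    ⟨append_singleton_mem_candidates hy.1 fun hya => ?_, hprefix⟩⟩
  simpa using hmax (y ++ [a]) ⟨List.mem_cons_of_mem _ hya, hprefix⟩

theorem numCandidates_append_singleton_pos (w : List Ω) (a : Ω) :
    0 < numCandidates w ((parse w).2 ++ [a]) := by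
  by_cases h : (parse w).2 ++ [a] ∈ (parse w).1
  · have : Nonempty Ω := ⟨a⟩
    exact numCandidates_pos (List.mem_cons_of_mem _ h)
  · exact Finset.card_pos.2 ⟨_, Finset.mem_filter.2
      ⟨append_singleton_mem_candidates (parse_snd_mem w) h, List.prefix_rfl⟩⟩

theorem sum_numCandidates_append_singleton {w x : List Ω} (hx : x ∈ [] :: (parse w).1) :
    ∑ a, numCandidates w (x ++ [a]) = numCandidates w x := by
  unfold numCandidates
  rw [← Finset.card_biUnion]
  · congr 1
    ext ξ
    simp only [Finset.mem_biUnion, Finset.mem_filter, Finset.mem_univ, true_and,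
      exists_and_left, and_congr_right_iff]
    refine fun hξ => ⟨fun ⟨a, ha⟩ => (List.prefix_append _ _).trans ha, ?_⟩
    rintro ⟨v, rfl⟩
    cases v with
    | nil => exact absurd hξ (by simpa using notMem_candidates hx)
    | cons a v => exact ⟨a, v, by simp⟩
  · intro a _ b _ hab
    refine Finset.disjoint_left.2 fun ξ ha hb => hab ?_
    have heq := List.IsPrefix.eq_of_length (List.prefix_of_prefix_length_le
      (Finset.mem_filter.1 ha).2 (Finset.mem_filter.1 hb).2 (by simp)) (by simp)
    simpa using heq

/-- The Lempel–Ziv conditional probabilities, with the arguments in the order of a predictor. -/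
noncomputable def predictorLZ (w : List Ω) (a : Ω) : ℝ :=
  condLZ a w

theorem probLZ_eq_wordProb (ω : ℕ → Ω) (n : ℕ) :
    probLZ ω n = wordProb predictorLZ (pre ω n) :=
  (wordProb_pre predictorLZ ω n).symm

variable [Nonempty Ω]

theorem isPredictor_predictorLZ : IsPredictor (predictorLZ (Ω := Ω)) where
  pos w a := div_pos (Nat.cast_pos.2 (numCandidates_append_singleton_pos w a))
    (Nat.cast_pos.2 (numCandidates_pos (parse_snd_mem w)))
  sum_eq_one w := by
    have hne : (numCandidates w (parse w).2 : ℝ) ≠ 0 :=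
      Nat.cast_ne_zero.2 (numCandidates_pos (parse_snd_mem w)).ne'
    simp only [predictorLZ, condLZ]
    rw [← Finset.sum_div, div_eq_one_iff_eq hne, ← Nat.cast_sum,
      sum_numCandidates_append_singleton (parse_snd_mem w)]

open Nat in
/-- Within a phrase the factors `Q_LZ` telescope to a quotient of numbers of candidates, and each
new phrase starts with at most `|Ω| (T + 1)` candidates, where `T` is the number of phrases. -/
theorem numCandidates_le_wordProb_mul (w : List Ω) :
    (numCandidates w (parse w).2 : ℝ) ≤ wordProb predictorLZ w *
      (Fintype.card Ω ^ ((parse w).1.length + 1) * ((parse w).1.length + 1)! : ℕ) := by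
  induction w using List.reverseRecOn with
  | nil => simpa [parse] using numCandidates_le ([] : List Ω) []
  | append_singleton w a ih =>
    set T := (parse w).1.length with hT
    have hphrase : (numCandidates w ((parse w).2 ++ [a]) : ℝ) ≤
        wordProb predictorLZ (w ++ [a]) * (Fintype.card Ω ^ (T + 1) * (T + 1)! : ℕ) := by
      have hpos : (0 : ℝ) < numCandidates w (parse w).2 :=
        Nat.cast_pos.2 (numCandidates_pos (parse_snd_mem w))
      rw [wordProb_append_singleton, predictorLZ, condLZ, mul_right_comm, ← mul_div_assoc,
        le_div_iff₀' hpos]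
      exact mul_le_mul_of_nonneg_right ih (Nat.cast_nonneg _)
    by_cases h : (parse w).2 ++ [a] ∈ (parse w).1
    · rw [numCandidates_append_of_mem h, parse_append_singleton_of_mem h]
      exact hphrase
    · have hlength : (parse (w ++ [a])).1.length = T + 1 := by
        simp [parse_append_singleton_of_notMem h, hT]
      have hone : (1 : ℝ) ≤ numCandidates w ((parse w).2 ++ [a]) :=
        Nat.one_le_cast.2 (numCandidates_append_singleton_pos w a)
      have hle := numCandidates_le (w ++ [a]) (parse (w ++ [a])).2
      rw [hlength] at hle ⊢
      calc (numCandidates (w ++ [a]) (parse (w ++ [a])).2 : ℝ)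
          ≤ (Fintype.card Ω * (T + 1 + 1) : ℕ) := Nat.cast_le.2 hle
        _ ≤ wordProb predictorLZ (w ++ [a]) * (Fintype.card Ω ^ (T + 1) * (T + 1)! : ℕ) *
              (Fintype.card Ω * (T + 1 + 1) : ℕ) :=
            le_mul_of_one_le_left (Nat.cast_nonneg _) (hone.trans hphrase)
        _ = _ := by
            rw [mul_assoc, ← Nat.cast_mul, pow_succ _ (T + 1), Nat.factorial_succ (T + 1)]
            ring_nf

theorem neg_log_wordProb_predictorLZ_le (w : List Ω) :
    -Real.log (wordProb predictorLZ w) ≤ ((parse w).1.length + 1) *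
      (Real.log (Fintype.card Ω) + Real.log ((parse w).1.length + 1)) := by
  set T := (parse w).1.length
  have hpos := isPredictor_predictorLZ.wordProb_pos w
  have hcard : (0 : ℝ) < Fintype.card Ω := Nat.cast_pos.2 Fintype.card_pos
  have hone : 1 ≤ wordProb predictorLZ w * (Fintype.card Ω * (T + 1) : ℝ) ^ (T + 1) :=
    calc (1 : ℝ) ≤ numCandidates w (parse w).2 :=
          Nat.one_le_cast.2 (numCandidates_pos (parse_snd_mem w))
      _ ≤ wordProb predictorLZ w * (Fintype.card Ω ^ (T + 1) * (T + 1).factorial : ℕ) :=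
          numCandidates_le_wordProb_mul w
      _ ≤ wordProb predictorLZ w * (Fintype.card Ω ^ (T + 1) * (T + 1) ^ (T + 1) : ℕ) := by
          gcongr
          exact Nat.factorial_le_pow _
      _ = wordProb predictorLZ w * (Fintype.card Ω * (T + 1) : ℝ) ^ (T + 1) := by
          push_cast
          rw [mul_pow]
  have hlog := Real.log_nonneg hone
  rw [Real.log_mul hpos.ne' (by positivity), Real.log_pow,
    Real.log_mul hcard.ne' (by positivity)] at hlog
  push_cast at hlog
  linarith

end LempelZiv

/-! ## Optimality of the Lempel–Ziv predictor -/

theorem succ_mul_log_succ_sub_mul_log_le {x : ℝ} (hx : 0 ≤ x) :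
    (x + 1) * Real.log (x + 1) - x * Real.log x ≤ x + 1 := by
  have hlog : Real.log (x + 1) ≤ x := by
    simpa using Real.log_le_sub_one_of_pos (x := x + 1) (by positivity)
  have hmul : x * (Real.log (x + 1) - Real.log x) ≤ 1 := by
    rcases hx.eq_or_lt with rfl | hx
    · simp
    · rw [← Real.log_div (by positivity) hx.ne']
      calc x * Real.log ((x + 1) / x) ≤ x * ((x + 1) / x - 1) := by
            gcongr
            exact Real.log_le_sub_one_of_pos (by positivity)
        _ = 1 := by field_simp; ring
  linarith

namespace UnifilarSource

variable {S Ω : Type*} [Fintype Ω] [DecidableEq Ω] [Nonempty Ω] (P : UnifilarSource S Ω)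

theorem log_wordProb_sub_log_wordProb_predictorLZ_le [Fintype S] (s : S) (w : List Ω) {θ : ℝ}
    (hθ : 0 < θ) (hθ' : θ < 1) :
    Real.log (wordProb (P.predictor s) w) - Real.log (wordProb predictorLZ w) ≤
      ((parse w).1.length + 1) *
        (Real.log (Fintype.card Ω) + Real.log (Fintype.card S * (1 - θ)⁻¹) + 1) -
          w.length * Real.log θ := by
  have hP := P.isPredictor_predictor s
  have hflatten : Real.log (wordProb (P.predictor s) w) ≤
      Real.log (wordProb (P.predictor s) (parse w).1.flatten) := by
    refine Real.log_le_log (hP.wordProb_pos w) ?_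
    conv_lhs => rw [← flatten_parse_append w]
    exact hP.wordProb_append_le _ _
  have hziv := P.log_wordProb_flatten_le_of_nodup s (nodup_parse w) hθ hθ'
  have hLZ := neg_log_wordProb_predictorLZ_le w
  set T : ℝ := ((parse w).1.length : ℝ)
  set K : ℝ := Fintype.card S * (1 - θ)⁻¹
  have hK : 1 ≤ K := one_le_mul_of_one_le_of_one_le
    (Nat.one_le_cast.2 (Fintype.card_pos_iff.2 ⟨s⟩))
    ((one_le_inv₀ (sub_pos.2 hθ')).2 (sub_le_self 1 hθ.le))
  have hT : 0 ≤ T := Nat.cast_nonneg _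
  have hlog_div : T * Real.log (K / T) = T * Real.log K - T * Real.log T := by
    rcases hT.eq_or_lt with h | h
    · simp [← h]
    · rw [Real.log_div (by positivity) h.ne', mul_sub]
  have hlength : (w.length : ℝ) * Real.log θ ≤ (parse w).1.flatten.length * Real.log θ :=
    mul_le_mul_of_nonpos_right (Nat.cast_le.2 (length_flatten_parse_le w))
      (Real.log_nonpos hθ.le hθ'.le)
  have hsucc := succ_mul_log_succ_sub_mul_log_le hT
  have hlogK := Real.log_nonneg hK
  linarith

theorem eventually_log_wordProb_sub_le [Finite S] (s : S) (ω : ℕ → Ω) {ε : ℝ} (hε : 0 < ε) :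
    ∀ᶠ n : ℕ in atTop, Real.log (wordProb (P.predictor s) (pre ω n)) -
      Real.log (wordProb predictorLZ (pre ω n)) ≤ ε * n := by
  cases nonempty_fintype S
  set θ := Real.exp (-(ε / 2))
  set D := Real.log (Fintype.card Ω) + Real.log (Fintype.card S * (1 - θ)⁻¹) + 1
  have hθ : θ < 1 := Real.exp_lt_one_iff.2 (by linarith)
  have hphrases : (fun n => (((parse (pre ω n)).1.length : ℝ) + 1) * D) =o[atTop]
      fun n : ℕ => (n : ℝ) := by
    simp only [mul_comm _ D]
    exact ((isLittleO_length_parse ω).add ((isLittleO_const_id_atTop (1 : ℝ)).comp_tendsto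
      tendsto_natCast_atTop_atTop)).const_mul_left D
  filter_upwards [hphrases.bound (half_pos hε)] with n hn
  have hbound := P.log_wordProb_sub_log_wordProb_predictorLZ_le s (pre ω n) (Real.exp_pos _) hθ
  rw [Real.log_exp, length_pre] at hbound
  rw [Real.norm_natCast] at hn
  linarith [Real.le_norm_self ((((parse (pre ω n)).1.length : ℝ) + 1) * D)]

theorem canForce_log_wordProb_sub [Finite S] (s : S) :
    CanForce (P.predictor s) fun ω =>
      (fun n => Real.log (wordProb (P.predictor s) (pre ω n)) -
        Real.log (wordProb predictorLZ (pre ω n))) =o[atTop] fun n : ℕ => (n : ℝ) := by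
  refine (CanForce.eventually_log_wordProb_le isPredictor_predictorLZ
    (P.isPredictor_predictor s)).mono fun ω hω => isLittleO_iff.2 fun ε hε => ?_
  filter_upwards [hω, isLittleO_log_succ.bound hε, P.eventually_log_wordProb_sub_le s ω hε]
    with n hlower hlog hupper
  rw [Real.norm_natCast] at hlog ⊢
  exact abs_le.2 ⟨by linarith [Real.le_norm_self (2 * Real.log ((n : ℝ) + 1))], hupper⟩

variable {P}

theorem IsIrreducible.canForce_tendsto_neg_log_probLZ_div [Fintype S] (hP : P.IsIrreducible)
    {π : S → ℝ} (hπ : P.IsInvariant π) (s : S) :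
    CanForce (P.predictor s) fun ω =>
      Tendsto (fun n : ℕ => -Real.log (probLZ ω n) / n) atTop (𝓝 (π ⬝ᵥ P.entropy)) := by
  refine ((hP.canForce_neg_log_wordProb_sub hπ s).and (P.canForce_log_wordProb_sub s)).mono
    fun ω ⟨hsurprisal, hredundancy⟩ => ?_
  have hlim := (hsurprisal.add hredundancy).tendsto_div_nhds_zero.add_const (π ⬝ᵥ P.entropy)
  rw [zero_add] at hlim
  refine hlim.congr' ?_
  filter_upwards [eventually_ne_atTop 0] with n hn
  rw [probLZ_eq_wordProb]
  field_simp
  ring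

end UnifilarSource

/-! ## The Markovian game -/

section Strategy

variable {Ω : Type*} [Fintype Ω] [DecidableEq Ω] {k : ℕ}

/-- The strategy that does not bet in the first `k` rounds and then multiplies the capital by at
least the growth factors of the supermartingale `F`. -/
noncomputable def followStrategy (k : ℕ) (F : List Ω → ℝ) (w : List Ω) (a : Ω) : ℝ :=
  if w.length < k then 0 else F (w ++ [a]) / F w

variable {q : List Ω → Ω → ℝ} {F : List Ω → ℝ} {p : ℕ → Ω → ℝ} {ω : ℕ → Ω}

theorem capital_followStrategy_of_le {n : ℕ} (hn : n ≤ k) :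
    capital (followStrategy k F) p ω n = 1 := by
  induction n with
  | zero => rfl
  | succ n ih =>
    have hnk : n < k := hn
    simp [capital, ih hnk.le, followStrategy, hnk]

theorem IsSupermartingale.div_le_one_add_sum (hF : IsSupermartingale q F) {n : ℕ} (hn : k ≤ n)
    (hp : p n = q (pre ω n)) :
    F (pre ω (n + 1)) / F (pre ω n) ≤
      1 + ∑ a, followStrategy k F (pre ω n) a * ((if ω n = a then 1 else 0) - p n a) := by
  have hbet (a : Ω) : followStrategy k F (pre ω n) a = F (pre ω n ++ [a]) / F (pre ω n) :=
    if_neg (by simpa using hn)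
  have hcost : (∑ a, q (pre ω n) a * F (pre ω n ++ [a])) / F (pre ω n) ≤ 1 :=
    div_le_one_of_le₀ (hF.sum_le _) (hF.pos _).le
  calc F (pre ω (n + 1)) / F (pre ω n)
      ≤ 1 + (F (pre ω n ++ [ω n]) / F (pre ω n) -
          (∑ a, q (pre ω n) a * F (pre ω n ++ [a])) / F (pre ω n)) := by
        rw [pre_succ]
        linarith
    _ = _ := by
        simp only [hbet, hp, mul_sub, Finset.sum_sub_distrib, mul_ite, mul_one, mul_zero,
          Finset.sum_ite_eq, Finset.mem_univ, if_true, Finset.sum_div, mul_div_assoc, mul_comm]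

theorem IsSupermartingale.div_le_capital_followStrategy (hF : IsSupermartingale q F)
    (hp : ∀ n, k ≤ n → p n = q (pre ω n)) {n : ℕ} (hn : k ≤ n) :
    F (pre ω n) / F (pre ω k) ≤ capital (followStrategy k F) p ω n := by
  induction n, hn using Nat.le_induction with
  | base => rw [capital_followStrategy_of_le le_rfl, div_self (hF.pos _).ne']
  | succ n hn ih =>
    have hratio (m n : ℕ) : 0 < F (pre ω n) / F (pre ω m) := div_pos (hF.pos _) (hF.pos _)
    calc F (pre ω (n + 1)) / F (pre ω k)
        = F (pre ω n) / F (pre ω k) * (F (pre ω (n + 1)) / F (pre ω n)) := by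
          rw [mul_comm, div_mul_div_cancel₀ (hF.pos _).ne']
      _ ≤ capital (followStrategy k F) p ω (n + 1) :=
          mul_le_mul ih (hF.div_le_one_add_sum hn (hp n hn)) (hratio _ _).le
            ((hratio _ _).le.trans ih)

theorem CanForce.exists_isPrudent {M : Ω → (Fin k → Ω) → ℝ} {E : (ℕ → Ω) → Prop}
    (hE : CanForce q E)
    (hq : ∀ p ω, IsPlay M p ω → ∀ n, k ≤ n → p n = q (pre ω n)) :
    ∃ α, IsPrudent M α ∧
      ∀ p ω, IsPlay M p ω → ¬ E ω → Tendsto (capital α p ω) atTop atTop := by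
  obtain ⟨F, hF, hlim⟩ := hE
  refine ⟨followStrategy k F, fun p ω h n => ?_, fun p ω h hω => ?_⟩
  · rcases le_total n k with hn | hn
    · exact one_pos.trans_eq (capital_followStrategy_of_le hn).symm
    · exact (div_pos (hF.pos _) (hF.pos _)).trans_le
        (hF.div_le_capital_followStrategy (hq p ω h) hn)
  · refine tendsto_atTop_mono' _ ?_ ((hlim ω hω).atTop_div_const (hF.pos (pre ω k)))
    filter_upwards [eventually_ge_atTop k] with n hn
      using hF.div_le_capital_followStrategy (hq p ω h) hn

end Strategy

section MarkovSource

variable {Ω : Type*} {k : ℕ}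

/-- The last `k` letters after one more letter has been appended. -/
def shift (s : Fin k → Ω) (a : Ω) : Fin k → Ω :=
  Fin.tail (Fin.snoc s a : Fin (k + 1) → Ω)

theorem foldl_shift_pre (s : Fin k → Ω) (ω : ℕ → Ω) (n : ℕ) (i : Fin k) (hi : k ≤ n + i) :
    (pre ω n).foldl shift s i = ω (n + i - k) := by
  induction n generalizing i with
  | zero => omega
  | succ n ih =>
    rw [pre_succ, List.foldl_append, List.foldl_cons, List.foldl_nil, shift, Fin.tail]
    by_cases h : (i : ℕ) + 1 < k
    · have hcast : i.succ = Fin.castSucc (⟨i + 1, h⟩ : Fin k) := Fin.ext rfl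
      rw [hcast, Fin.snoc_castSucc, ih ⟨i + 1, h⟩ (by simp only; omega)]
      congr 1
      simp only
      omega
    · have hlast : i.succ = Fin.last k := Fin.ext (by simp; omega)
      rw [hlast, Fin.snoc_last]
      congr 1
      omega

theorem exists_foldl_shift_eq (s t : Fin k → Ω) : ∃ w : List Ω, w.foldl shift s = t := by
  rcases isEmpty_or_nonempty (Fin k) with hk | ⟨⟨j⟩⟩
  · exact ⟨[], Subsingleton.elim _ _⟩
  refine ⟨pre (fun n => if h : n < k then t ⟨n, h⟩ else t j) k, funext fun i => ?_⟩
  rw [foldl_shift_pre _ _ _ _ (Nat.le_add_right _ _), Nat.add_sub_cancel_left, dif_pos i.2]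

variable [Fintype Ω] {M : Ω → (Fin k → Ω) → ℝ}

theorem IsPlay.forecast_eq {p : ℕ → Ω → ℝ} {ω : ℕ → Ω} (h : IsPlay M p ω) (s : Fin k → Ω)
    {n : ℕ} (hn : k ≤ n) (a : Ω) : p n a = M a ((pre ω n).foldl shift s) := by
  rw [h.markov n hn]
  congr 1
  ext i
  rw [foldl_shift_pre _ _ _ _ (by omega)]
  congr 1
  omega

/-- Both sides are sums over words of length `k + 1`, split at the last and at the first
letter. -/
theorem IsStationary.sum_mul_sum_shift {π : (Fin k → Ω) → ℝ} (hπ : IsStationary M π)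
    (g : (Fin k → Ω) → ℝ) :
    ∑ s, π s * ∑ a, M a s * g (shift s a) = ∑ s, π s * g s := by
  set G : (Fin (k + 1) → Ω) → ℝ := fun x =>
    M (x (Fin.last k)) (Fin.init x) * π (Fin.init x) * g (Fin.tail x) with hG
  calc ∑ s, π s * ∑ a, M a s * g (shift s a)
      = ∑ x, G x := by
        rw [← (Fin.snocEquiv fun _ : Fin (k + 1) => Ω).sum_comp, Fintype.sum_prod_type_right]
        simp only [hG, Fin.snocEquiv, Equiv.coe_fn_mk, Fin.snoc_last, Fin.init_snoc, shift,
          Finset.mul_sum]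
        exact Finset.sum_congr rfl fun s _ => Finset.sum_congr rfl fun a _ => by ring
    _ = ∑ c, π c * g c := by
        rw [← (Fin.consEquiv fun _ : Fin (k + 1) => Ω).sum_comp, Fintype.sum_prod_type_right]
        refine Finset.sum_congr rfl fun c _ => ?_
        rw [hπ.invariant c, Finset.sum_mul]
        simp only [hG, Fin.consEquiv, Equiv.coe_fn_mk, Fin.tail_cons]

/-- A `k`-th order Markov kernel as a source whose state is the word of the last `k` letters. -/
def markovSource (hM : IsMarkovKernel M) : UnifilarSource (Fin k → Ω) Ω where
  step := shift
  prob s a := M a s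
  prob_pos s a := ((hM s).mem_Ioo a).1
  sum_prob s := (hM s).sum_eq_one

theorem isIrreducible_markovSource (hM : IsMarkovKernel M) : (markovSource hM).IsIrreducible :=
  exists_foldl_shift_eq

variable {π : (Fin k → Ω) → ℝ}

theorem IsStationary.isInvariant_markovSource (hπ : IsStationary M π)
    (hM : IsMarkovKernel M) : (markovSource hM).IsInvariant π where
  sum_eq_one := hπ.sum_eq_one
  dotProduct_expect := hπ.sum_mul_sum_shift

theorem dotProduct_entropy_markovSource (hM : IsMarkovKernel M) :
    π ⬝ᵥ (markovSource hM).entropy = entropyRate M π := by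
  simp [dotProduct, UnifilarSource.entropy, markovSource, entropyRate, Real.negMulLog]

end MarkovSource

end LZGame

theorem mainTheorem2 {Ω : Type*} [Fintype Ω] [DecidableEq Ω] (k : ℕ)
    (M : Ω → (Fin k → Ω) → ℝ) (hM : LZGame.IsMarkovKernel M)
    (π : (Fin k → Ω) → ℝ) (hπ : LZGame.IsStationary M π) :
    ∃ α : List Ω → Ω → ℝ, LZGame.IsPrudent M α ∧
      ∀ (p : ℕ → Ω → ℝ) (ω : ℕ → Ω), LZGame.IsPlay M p ω →
        ¬ Filter.Tendsto (fun n : ℕ => -Real.log (LZGame.probLZ ω n) / (n : ℝ)) Filter.atTop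
            (nhds (LZGame.entropyRate M π)) →
        Filter.Tendsto (LZGame.capital α p ω) Filter.atTop Filter.atTop := by
  have hword : Nonempty (Fin k → Ω) := by
    by_contra hempty
    rw [not_nonempty_iff] at hempty
    exact zero_ne_one (Fintype.sum_empty π ▸ hπ.sum_eq_one)
  obtain ⟨s⟩ := hword
  have hletter : Nonempty Ω := by
    by_contra hempty
    rw [not_nonempty_iff] at hempty
    exact zero_ne_one (Fintype.sum_empty (fun a => M a s) ▸ (hM s).sum_eq_one)
  have hforce := (LZGame.isIrreducible_markovSource hM).canForce_tendsto_neg_log_probLZ_div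
    (hπ.isInvariant_markovSource hM) s
  rw [LZGame.dotProduct_entropy_markovSource] at hforce
  exact hforce.exists_isPrudent fun p ω hplay n hn => funext (hplay.forecast_eq s hn)
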